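/- All graphs are finite and simple. For a graph $G$, let $\alpha(G)$, $\chi(G)$ and $\Delta(G)$ denote its independence number, chromatic number and maximum degree; the clique covering number of $G$ is the minimum number of cliques of $G$ whose union is $V(G)$. A strong immersion of a graph $H$ in $G$ is a minimal subgraph $I$ of $G$ for which there are an injection $\mathrm{i}\colon V(H)\to V(I)$ and pairwise edge-disjoint paths $P_e$ in $I$, one for each $e\in E(H)$, such that for every edge $uv\in E(H)$ the end vertices of $P_{uv}$ are precisely $\mathrm{i}(u)$ and $\mathrm{i}(v)$, and no internal vertex of $P_{uv}$ belongs to $\mathrm{i}(V(H))$. Theorem. Let $G$ be a graph on $n$ vertices with $\alpha(G)=2$ and clique covering number at most $3$. If $\Delta(G)<\frac{2n}{3}-1$, then $G$ contains a strong immersion of the complete graph $K_{\chi(G)}$. -/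

import Mathlib

namespace SimpleGraph

variable {V W : Type*}

/-- The clique covering number: the least number of cliques of `G` whose union is the whole vertex
set (`⊤` if no finite number of cliques suffices, which does not happen for finite graphs). -/
noncomputable def cliqueCoveringNumber (G : SimpleGraph V) : ℕ∞ :=
  ⨅ k ∈ {k : ℕ | ∃ C : Fin k → Set V, (∀ i, G.IsClique (C i)) ∧ ⋃ i, C i = Set.univ}, (k : ℕ∞)

/-- An injection of the vertices of `H` into the vertices of the subgraph `I` of `G`, together with
pairwise edge-disjoint paths in `I`, one for each edge of `H`, such that the path of the edge `uv`
joins the images of `u` and `v`. The values of `path` outside `H.edgeSet` are irrelevant. -/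
structure ImmersionModel (H : SimpleGraph W) {G : SimpleGraph V} (I : G.Subgraph) where
  branch : W ↪ V
  branch_mem : ∀ w, branch w ∈ I.verts
  path : Sym2 W → G.Subgraph
  path_le : ∀ e ∈ H.edgeSet, path e ≤ I
  isPath : ∀ u v, H.Adj u v →
    ∃ p : G.Walk (branch u) (branch v), p.IsPath ∧ p.toSubgraph = path s(u, v)
  edge_disjoint : H.edgeSet.PairwiseDisjoint fun e => (path e).edgeSet

/-- No internal vertex of a path of the model is a branch vertex. -/
def ImmersionModel.IsStrong {H : SimpleGraph W} {G : SimpleGraph V} {I : G.Subgraph}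
    (M : ImmersionModel H I) : Prop :=
  ∀ u v, H.Adj u v → ∀ w, M.branch w ∈ (M.path s(u, v)).verts → w = u ∨ w = v

/-- `I` is a strong immersion of `H` in `G`: a minimal subgraph of `G` that carries a model of `H`
in which the internal vertices of the paths are not branch vertices. -/
def IsStrongImmersion (H : SimpleGraph W) {G : SimpleGraph V} (I : G.Subgraph) : Prop :=
  Minimal (fun J : G.Subgraph => ∃ M : ImmersionModel H J, M.IsStrong) I

/-- `G` contains a strong immersion of `H`. -/
def ContainsStrongImmersion (G : SimpleGraph V) (H : SimpleGraph W) : Prop :=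
  ∃ I : G.Subgraph, IsStrongImmersion H I

end SimpleGraph

/-! The complement `H` of `G` is triangle-free, is properly 3-coloured by the clique cover, and has
minimum degree above n/3. Two facts about such graphs suffice.

χ(G) ≤ max(⌈n/2⌉, ω(G)): a colouring with classes of size at most two is a matching of `H`, and
Tutte's theorem supplies one (`exists_isPerfectMatching_joinComplete`). If ω(G) ≥ n/2, a maximum
clique already settles the theorem.

Otherwise `G` strongly immerses a complete graph on ⌈n/2⌉ vertices. Make `H` edge-maximal, which
only removes edges from its complement. The neighbourhoods between two colour classes are then
nested, so the vertices fit on a circle with every neighbourhood an arc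
(`IsSaturatedColored.nonempty_circularOrdering`). A suitable run of ⌈n/2⌉ consecutive vertices
serves as branch vertices, and pairs adjacent in `H` are joined through two of the remaining
vertices (`CircularOrdering.containsStrongImmersion`). -/

namespace SimpleGraph

variable {V : Type*}

/-! ### Strong immersions of complete graphs from path systems -/

/-- A family of paths joining all pairs of branch vertices, with pairwise disjoint edges and no
internal branch vertices, yields a strong immersion of a complete graph. -/
theorem containsStrongImmersion_completeGraph_of_paths [Finite V] {G : SimpleGraph V} {k : ℕ}
    (b : Fin k ↪ V) (P : ∀ x y : Fin k, G.Walk (b x) (b y))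
    (hP : ∀ x y, x < y → (P x y).IsPath)
    (hstrong : ∀ x y, x < y → ∀ w, b w ∈ (P x y).support → w = x ∨ w = y)
    (hdisj : ∀ x y x' y', x < y → x' < y' → ∀ e, e ∈ (P x y).edges → e ∈ (P x' y').edges →
      x = x' ∧ y = y') :
    G.ContainsStrongImmersion (completeGraph (Fin k)) := by
  classical
  -- Each edge is oriented from its smaller to its larger index, so only the walks `P x y` with `x <
  -- y` matter.
  let path : Sym2 (Fin k) → G.Subgraph := fun e => (P e.inf e.sup).toSubgraph
  have hlt : ∀ e ∈ (completeGraph (Fin k)).edgeSet, e.inf < e.sup := by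
    intro e he
    induction e with
    | _ u v =>
      have : u ≠ v := by simpa using he
      simpa using this.symm
  have hpath : ∀ u v, u ≠ v → ∃ p : G.Walk (b u) (b v), p.IsPath ∧
      p.toSubgraph = path s(u, v) := by
    intro u v huv
    rcases lt_or_gt_of_ne huv with h | h
    · have h1 : s(u, v).inf = u := by simp [h.le]
      have h2 : s(u, v).sup = v := by simp [h.le]
      refine ⟨P u v, hP u v h, ?_⟩
      simp only [path]
      rw [h1, h2]
    · have h1 : s(u, v).inf = v := by simp [h.le]
      have h2 : s(u, v).sup = u := by simp [h.le]
      refine ⟨(P v u).reverse, (hP v u h).reverse, ?_⟩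
      simp only [path]
      rw [h1, h2, Walk.toSubgraph_reverse]
  let M : ImmersionModel (completeGraph (Fin k)) (⊤ : G.Subgraph) :=
    { branch := b
      branch_mem := fun w => by simp
      path := path
      path_le := fun e _ => le_top
      isPath := fun u v huv => hpath u v huv
      edge_disjoint := by
        intro e he f hf hef
        rw [Function.onFun, Set.disjoint_left]
        intro a ha ha'
        apply hef
        obtain ⟨h1, h2⟩ := hdisj _ _ _ _ (hlt e he) (hlt f hf) a
          (by simpa [path] using ha) (by simpa [path] using ha')
        exact Sym2.inf_eq_inf_and_sup_eq_sup.mp ⟨h1, h2⟩ }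
  have hM : M.IsStrong := by
    intro u v huv w hw
    have huv' : u ≠ v := huv
    have hw' : b w ∈ (P s(u, v).inf s(u, v).sup).support := by
      simpa [M, path] using hw
    have := hstrong _ _ (hlt s(u, v) (by simpa using huv')) w hw'
    rcases lt_or_gt_of_ne huv' with h | h
    · simpa [h.le] using this
    · simpa [h.le, or_comm] using this
  obtain ⟨I, -, hI⟩ := (Set.toFinite {J : G.Subgraph |
    ∃ M : ImmersionModel (completeGraph (Fin k)) J, M.IsStrong}).exists_le_minimal
      (show (⊤ : G.Subgraph) ∈ _ from ⟨M, hM⟩)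
  exact ⟨I, hI⟩

theorem containsStrongImmersion_completeGraph_of_isClique [Finite V] {G : SimpleGraph V}
    {k : ℕ} (b : Fin k ↪ V) (h : ∀ x y, x ≠ y → G.Adj (b x) (b y)) :
    G.ContainsStrongImmersion (completeGraph (Fin k)) := by
  classical
  have hp : ∀ x y : Fin k, ∃ p : G.Walk (b x) (b y), x < y →
      p.support = [b x, b y] ∧ p.edges = [s(b x, b y)] := by
    intro x y
    by_cases hxy : x = y
    · subst hxy; exact ⟨Walk.nil, fun h => absurd h (lt_irrefl _)⟩
    · exact ⟨(h x y hxy).toWalk, fun _ => by simp⟩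
  choose P hP using hp
  refine containsStrongImmersion_completeGraph_of_paths b P ?_ ?_ ?_
  · intro x y hxy
    rw [Walk.isPath_def, (hP x y hxy).1]
    simp [hxy.ne]
  · intro x y hxy w hw
    simpa [(hP x y hxy).1] using hw
  · intro x y x' y' hxy hxy' e he he'
    rw [(hP x y hxy).2, List.mem_singleton] at he
    rw [(hP x' y' hxy').2, List.mem_singleton] at he'
    subst he
    rcases Sym2.eq_iff.mp he' with ⟨h1, h2⟩ | ⟨h1, h2⟩
    · exact ⟨b.injective h1, b.injective h2⟩
    · have h1 := b.injective h1
      have h2 := b.injective h2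
      subst h1 h2
      exact absurd hxy (lt_asymm hxy')

/-- Nonadjacent branch vertices `x < y` are joined through two auxiliary vertices `σ y` and `τ x`. -/
theorem containsStrongImmersion_completeGraph_of_detours [Finite V] {G : SimpleGraph V} {k : ℕ}
    (b : Fin k ↪ V) (σ τ : Fin k → V) (B : Fin k → Fin k → Prop)
    (hgood : ∀ x y, x < y → ¬ B x y → G.Adj (b x) (b y))
    (hσ : ∀ x y, B x y → ∀ w, σ y ≠ b w) (hτ : ∀ x y, B x y → ∀ w, τ x ≠ b w)
    (hbσ : ∀ x y, B x y → G.Adj (b x) (σ y)) (hστ : ∀ x y, B x y → G.Adj (σ y) (τ x))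
    (hτb : ∀ x y, B x y → G.Adj (τ x) (b y))
    (hσinj : Function.Injective σ) (hτinj : Function.Injective τ)
    (htrans : ∀ x y z, B x y → ¬ B y z)
    (hcross : ∀ x y x' y', B x y → B x' y' → σ y = τ x' → τ x ≠ σ y') :
    G.ContainsStrongImmersion (completeGraph (Fin k)) := by
  classical
  have hp : ∀ x y : Fin k, ∃ p : G.Walk (b x) (b y), x < y →
      (¬ B x y → p.support = [b x, b y] ∧ p.edges = [s(b x, b y)]) ∧
      (B x y → p.support = [b x, σ y, τ x, b y] ∧
        p.edges = [s(b x, σ y), s(σ y, τ x), s(τ x, b y)]) := by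
    intro x y
    by_cases hxy : x < y
    · by_cases hB : B x y
      · exact ⟨.cons (hbσ x y hB) (.cons (hστ x y hB) (.cons (hτb x y hB) .nil)),
          fun _ => ⟨fun h => absurd hB h, fun _ => by simp⟩⟩
      · exact ⟨(hgood x y hxy hB).toWalk, fun _ => ⟨fun _ => by simp, fun h => absurd h hB⟩⟩
    · by_cases hne : x = y
      · subst hne; exact ⟨Walk.nil, fun h => absurd h hxy⟩
      · by_cases hB : B y x
        · exact ⟨(Walk.cons (hbσ y x hB) (.cons (hστ y x hB) (.cons (hτb y x hB) .nil))).reverse,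
            fun h => absurd h hxy⟩
        · exact ⟨(hgood y x (lt_of_le_of_ne (not_lt.mp hxy) (Ne.symm hne)) hB).symm.toWalk,
            fun h => absurd h hxy⟩
  choose P hP using hp
  have hb : ∀ {x y}, b x = b y ↔ x = y := b.injective.eq_iff
  refine containsStrongImmersion_completeGraph_of_paths b P ?_ ?_ ?_
  · intro x y hxy
    rw [Walk.isPath_def]
    by_cases hB : B x y
    · rw [((hP x y hxy).2 hB).1]
      have h1 := (hσ x y hB x).symm
      have h2 := (hτ x y hB x).symm
      have h3 := (hστ x y hB).ne
      have h4 := hσ x y hB y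
      have h5 := hτ x y hB y
      simp [h1, h2, h3, h4, h5, hxy.ne]
    · rw [((hP x y hxy).1 hB).1]
      simp [hxy.ne]
  · intro x y hxy w hw
    by_cases hB : B x y
    · rw [((hP x y hxy).2 hB).1] at hw
      simpa [(hσ x y hB w).symm, (hτ x y hB w).symm] using hw
    · simpa [((hP x y hxy).1 hB).1] using hw
  · intro x y x' y' hxy hxy' e he he'
    by_cases hB : B x y <;> by_cases hB' : B x' y'
    · rw [((hP x y hxy).2 hB).2] at he
      rw [((hP x' y' hxy').2 hB').2] at he'
      have := hσ x y hB; have := hτ x y hB; have := hσ x' y' hB'; have := hτ x' y' hB'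
      -- If the edge `b x`–`σ y` equals `τ x'`–`b y'`, then `x = y'`, and `x', x, y` contradict
      -- `htrans`. Equal middle edges with their ends swapped are excluded by `hcross`; the other
      -- coincidences fall to injectivity.
      have := hcross x y x' y' hB hB'
      have := htrans x y y' hB; have := htrans x' y' y hB'
      simp only [List.mem_cons, List.not_mem_nil, or_false] at he he'
      rcases he with rfl | rfl | rfl <;> rcases he' with h | h | h <;>
        rcases Sym2.eq_iff.mp h with ⟨h1, h2⟩ | ⟨h1, h2⟩ <;> grind [Function.Injective]
    · rw [((hP x y hxy).2 hB).2] at he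
      rw [((hP x' y' hxy').1 hB').2] at he'
      have := hσ x y hB; have := hτ x y hB
      simp only [List.mem_cons, List.not_mem_nil, or_false] at he he'
      rcases he with rfl | rfl | rfl <;> rcases Sym2.eq_iff.mp he' with ⟨h1, h2⟩ | ⟨h1, h2⟩ <;> grind
    · rw [((hP x y hxy).1 hB).2] at he
      rw [((hP x' y' hxy').2 hB').2] at he'
      have := hσ x' y' hB'; have := hτ x' y' hB'
      simp only [List.mem_cons, List.not_mem_nil, or_false] at he he'
      rcases he' with rfl | rfl | rfl <;> rcases Sym2.eq_iff.mp he with ⟨h1, h2⟩ | ⟨h1, h2⟩ <;> grind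
    · rw [((hP x y hxy).1 hB).2, List.mem_singleton] at he
      rw [((hP x' y' hxy').1 hB').2, List.mem_singleton] at he'
      subst he
      rcases Sym2.eq_iff.mp he' with ⟨h1, h2⟩ | ⟨h1, h2⟩ <;> rw [hb] at h1 h2
      · exact ⟨h1, h2⟩
      · subst h1 h2
        exact absurd hxy (lt_asymm hxy')

/-! ### Saturated graphs: nested neighbourhoods between colour classes -/

/-- A graph that is edge-maximal among the triangle-free graphs properly coloured by `c`. -/
structure IsSaturatedColored {α : Type*} (H : SimpleGraph V) (c : V → α) : Prop where
  color_ne : ∀ {u v}, H.Adj u v → c u ≠ c v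
  no_triangle : ∀ {u v w}, H.Adj u v → H.Adj v w → ¬ H.Adj u w
  common : ∀ {u v}, c u ≠ c v → ¬ H.Adj u v → ∃ w, H.Adj u w ∧ H.Adj v w

theorem exists_isSaturatedColored_le [Finite V] {α : Type*} (H : SimpleGraph V) (c : V → α)
    (hc : ∀ {u v}, H.Adj u v → c u ≠ c v)
    (ht : ∀ {u v w}, H.Adj u v → H.Adj v w → ¬ H.Adj u w) :
    ∃ H' : SimpleGraph V, H ≤ H' ∧ H'.IsSaturatedColored c := by
  obtain ⟨H', hle, hmax⟩ := (Set.toFinite {K : SimpleGraph V |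
    (∀ u v, K.Adj u v → c u ≠ c v) ∧
      (∀ u v w, K.Adj u v → K.Adj v w → ¬ K.Adj u w)}).exists_le_maximal
    (show H ∈ _ from ⟨fun _ _ => hc, fun _ _ _ => ht⟩)
  obtain ⟨hc', ht'⟩ := hmax.prop
  refine ⟨H', hle, ⟨hc' _ _, ht' _ _ _, ?_⟩⟩
  intro u v huv hnadj
  by_contra! hcommon
  have hne : u ≠ v := fun h => huv (congrArg c h)
  have hadj : ∀ a b, (H' ⊔ edge u v).Adj a b ↔
      H'.Adj a b ∨ (a = u ∧ b = v ∨ a = v ∧ b = u) := by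
    intro a b
    rw [sup_adj, edge_adj]
    grind
  have hmem : H' ⊔ edge u v ∈ {K : SimpleGraph V |
    (∀ u v, K.Adj u v → c u ≠ c v) ∧
      (∀ u v w, K.Adj u v → K.Adj v w → ¬ K.Adj u w)} := by
    constructor
    · intro a b h
      rcases (hadj a b).mp h with h | ⟨rfl, rfl⟩ | ⟨rfl, rfl⟩
      · exact hc' _ _ h
      · exact huv
      · exact huv.symm
    · intro a b d
      rw [hadj, hadj, hadj]
      have h1 := ht' a b d
      have h2 := fun w => hcommon w
      have h3 : ∀ x y, H'.Adj x y → H'.Adj y x := fun _ _ h => h.symm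
      have h4 : ∀ x, ¬ H'.Adj x x := fun x => H'.irrefl
      grind
  have := hmax.le_of_ge hmem le_sup_left (show (H' ⊔ edge u v).Adj u v from
    (hadj u v).mpr (Or.inr (Or.inl ⟨rfl, rfl⟩)))
  exact hnadj this

namespace IsSaturatedColored

variable [Fintype V] {H : SimpleGraph V} [DecidableRel H.Adj] {c : V → Fin 3}

/-- Between two colour classes the neighbourhoods form a chain. -/
theorem adj_or_adj (hH : H.IsSaturatedColored c)
    (hdeg : ∀ v, Fintype.card V < 3 * H.degree v) {x x' y y' : V} (hx : c x = c x')
    (hy : c y = c y') (hxy : H.Adj x y) (hxy' : H.Adj x' y') : H.Adj x y' ∨ H.Adj x' y := by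
  classical
  by_contra! hcon
  obtain ⟨h1, h2⟩ := hcon
  have hne := hH.color_ne hxy
  obtain ⟨z, hxz, hyz⟩ := hH.common (hy ▸ hne) h1
  obtain ⟨z', hxz', hyz'⟩ := hH.common (show c x' ≠ c y from hx ▸ hne) h2
  -- The vertices `x, y, z', x', y', z` form a 6-cycle. A vertex adjacent to three of them would see
  -- an alternating triple, which carries all three colours and leaves none for `v`. So the six
  -- degrees sum to at most 2n, although each exceeds n/3.
  have key : ∀ v, (if H.Adj x v then 1 else 0) + (if H.Adj y v then 1 else 0)
      + (if H.Adj z' v then 1 else 0) + (if H.Adj x' v then 1 else 0)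
      + (if H.Adj y' v then 1 else 0) + (if H.Adj z v then 1 else 0) ≤ 2 := by
    intro v
    have a1 : H.Adj x v → ¬ H.Adj y v := fun h h' => hH.no_triangle hxy h' h
    have a2 : H.Adj y v → ¬ H.Adj z' v := fun h h' => hH.no_triangle hyz' h' h
    have a3 : H.Adj x' v → ¬ H.Adj z' v := fun h h' => hH.no_triangle hxz' h' h
    have a4 : H.Adj x' v → ¬ H.Adj y' v := fun h h' => hH.no_triangle hxy' h' h
    have a5 : H.Adj y' v → ¬ H.Adj z v := fun h h' => hH.no_triangle hyz h' h
    have a6 : H.Adj x v → ¬ H.Adj z v := fun h h' => hH.no_triangle hxz h' h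
    have c1 := hH.color_ne hxz
    have c2 := hH.color_ne hyz
    have c3 := hH.color_ne hxz'
    have c4 := hH.color_ne hyz'
    have b1 : H.Adj x v → H.Adj z' v → ¬ H.Adj y' v := fun h h' h'' => by
      have := hH.color_ne h; have := hH.color_ne h'; have := hH.color_ne h''
      omega
    have b2 : H.Adj y v → H.Adj x' v → ¬ H.Adj z v := fun h h' h'' => by
      have := hH.color_ne h; have := hH.color_ne h'; have := hH.color_ne h''
      omega
    by_cases e1 : H.Adj x v <;> by_cases e2 : H.Adj y v <;> by_cases e3 : H.Adj z' v <;>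
      by_cases e4 : H.Adj x' v <;> by_cases e5 : H.Adj y' v <;> by_cases e6 : H.Adj z v <;>
      simp_all
  have hd : ∀ u, H.degree u = ∑ v, if H.Adj u v then 1 else 0 := by
    intro u
    rw [← card_neighborFinset_eq_degree, neighborFinset_eq_filter, Finset.card_filter]
  have hsum := Finset.sum_le_sum (fun v (_ : v ∈ Finset.univ) => key v)
  simp only [Finset.sum_add_distrib, ← hd, Finset.sum_const, Finset.card_univ, smul_eq_mul]
    at hsum
  have := hdeg x; have := hdeg y; have := hdeg z'; have := hdeg x'
  have := hdeg y'; have := hdeg z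
  omega

end IsSaturatedColored

/-- The number of neighbours of `v` in the colour class following its own. -/
def nextDegree [Fintype V] (H : SimpleGraph V) [DecidableRel H.Adj] (c : V → Fin 3) (v : V) : ℕ :=
  (Finset.univ.filter fun w => H.Adj v w ∧ c w = c v + 1).card

namespace IsSaturatedColored

variable [Fintype V] {H : SimpleGraph V} [DecidableRel H.Adj] {c : V → Fin 3}

/-- Neighbourhoods in the next class are nested by `adj_or_adj`, so comparing their sizes compares
them as sets. -/
theorem adj_next_of_nextDegree_le (hH : H.IsSaturatedColored c)
    (hdeg : ∀ v, Fintype.card V < 3 * H.degree v) {x x' y : V} (hx : c x = c x')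
    (hle : H.nextDegree c x' ≤ H.nextDegree c x) (hy : c y = c x + 1) (h : H.Adj x' y) :
    H.Adj x y := by
  by_contra hn
  refine absurd hle (not_le.mpr (Finset.card_lt_card ?_))
  rw [Finset.ssubset_iff_of_subset]
  · exact ⟨y, by simp [h, hy, hx], by simp [hn]⟩
  · intro w hw
    simp only [Finset.mem_filter, Finset.mem_univ, true_and] at hw ⊢
    refine ⟨?_, by rw [hw.2, hx]⟩
    exact (hH.adj_or_adj hdeg hx (hw.2.trans hy.symm) hw.1 h).resolve_left hn

/-- If `x'` and `z` were nonadjacent, saturation would give them a common neighbour in the next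
class; that vertex is also adjacent to `x`, closing a triangle with `x` and `z`. Thus one order of a
class serves both other classes, in opposite directions. -/
theorem adj_prev_of_nextDegree_le (hH : H.IsSaturatedColored c)
    (hdeg : ∀ v, Fintype.card V < 3 * H.degree v) {x x' z : V} (hx : c x = c x')
    (hle : H.nextDegree c x' ≤ H.nextDegree c x) (hz : c z = c x + 2) (h : H.Adj x z) :
    H.Adj x' z := by
  by_contra hn
  obtain ⟨y, hxy, hzy⟩ := hH.common (show c x' ≠ c z by omega) hn
  have h1 := hH.color_ne hxy
  have h2 := hH.color_ne hzy
  exact hH.no_triangle h hzy (hH.adj_next_of_nextDegree_le hdeg hx hle (by omega) hxy)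

end IsSaturatedColored

/-! ### Circular orderings and their construction -/

/-- A periodic enumeration of the vertices of `H` for which the neighbours of each vertex that
follow it within one period form an interval; `reach i` is the first neighbour after `i`. -/
structure CircularOrdering (H : SimpleGraph V) (n : ℤ) where
  vertex : ℤ → V
  vertex_ne : ∀ {i j}, i < j → j < i + n → vertex i ≠ vertex j
  reach : ℤ → ℤ
  lt_reach : ∀ i, i < reach i
  reach_mono : Monotone reach
  adj_iff : ∀ {i j}, i < j → j < i + n →
    (H.Adj (vertex i) (vertex j) ↔ reach i ≤ j ∧ reach j ≤ i + n)

/-- A periodic enumeration of a three-coloured graph along which the colour classes alternate, in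
which earlier vertices of a class have more neighbours in the next class and fewer in the previous
one, gives a circular ordering. -/
theorem nonempty_circularOrdering_of_classes {H : SimpleGraph V} {n : ℤ} (e : ℤ → V) (C : ℤ → ℤ)
    (hper : ∀ i, e (i + n) = e i) (hne : ∀ {i j}, i < j → j < i + n → e i ≠ e j)
    (hsurj : ∀ v i, ∃ j, i ≤ j ∧ j < i + n ∧ e j = v)
    (hCmono : Monotone C) (hCper : ∀ i, C (i + n) = C i + 3)
    (hcol : ∀ i j, H.Adj (e i) (e j) → C i ≠ C j ∧ C j ≠ C i + 3)
    (hnext : ∀ {i i' j}, i ≤ i' → C i = C i' → C j = C i + 1 → H.Adj (e i') (e j) →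
      H.Adj (e i) (e j))
    (hprev : ∀ {i i' j}, i ≤ i' → C i = C i' → C j = C i + 2 → H.Adj (e i) (e j) →
      H.Adj (e i') (e j))
    (hpos : ∀ v, ∃ w, H.Adj v w) :
    Nonempty (H.CircularOrdering n) := by
  classical
  have hex : ∀ i, ∃ k : ℕ, H.Adj (e i) (e (i + k)) := by
    intro i
    obtain ⟨w, hw⟩ := hpos (e i)
    obtain ⟨j, hij, -, rfl⟩ := hsurj w i
    exact ⟨(j - i).toNat, by rwa [Int.toNat_of_nonneg (by omega), add_sub_cancel]⟩
  let g : ℤ → ℤ := fun i => i + Nat.find (hex i)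
  have hg : ∀ i, H.Adj (e i) (e (g i)) := fun i => Nat.find_spec (hex i)
  have hmin : ∀ i j, i ≤ j → H.Adj (e i) (e j) → g i ≤ j := by
    intro i j hij h
    have : Nat.find (hex i) ≤ (j - i).toNat := Nat.find_min' (hex i)
      (by rwa [Int.toNat_of_nonneg (by omega), add_sub_cancel])
    simp only [g]
    omega
  have hlt : ∀ i, i < g i := by
    intro i
    rcases (show i ≤ g i by simp only [g]; omega).lt_or_eq with h | h
    · exact h
    · exact absurd (hg i) (by rw [← h]; exact H.irrefl)
  have hgn : ∀ i, g i < i + n := by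
    intro i
    obtain ⟨w, hw⟩ := hpos (e i)
    obtain ⟨j, hij, hj, rfl⟩ := hsurj w i
    exact (hmin i j hij hw).trans_lt hj
  -- the class of a forward neighbour
  have hclass : ∀ i j, i ≤ j → j ≤ i + n → H.Adj (e i) (e j) → C j = C i + 1 ∨ C j = C i + 2 := by
    intro i j h1 h2 h
    have := hCmono h1
    have := hCmono h2
    have := hCper i
    have := hcol i j h
    omega
  -- monotonicity of forward adjacency towards the next two classes
  have hfwd : ∀ {i j j'}, j ≤ j' → C j = C j' → C j = C i + 1 → H.Adj (e i) (e j) →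
      H.Adj (e i) (e j') := by
    intro i j j' h1 h2 h3 h
    rw [← hper i] at h ⊢
    have := hCper i
    exact (hprev h1 h2 (by omega) h.symm).symm
  have hbwd : ∀ {i j j'}, j' ≤ j → C j = C j' → C j = C i + 2 → H.Adj (e i) (e j) →
      H.Adj (e i) (e j') := by
    intro i j j' h1 h2 h3 h
    rw [← hper i] at h ⊢
    have := hCper i
    exact (hnext h1 h2.symm (by omega) h.symm).symm
  refine ⟨⟨e, hne, g, hlt, ?_, ?_⟩⟩
  · intro i j hij
    rcases hij.eq_or_lt with rfl | hij
    · exact le_rfl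
    by_contra! hlt'
    have hi := hclass i (g i) (hlt i).le (hgn i).le (hg i)
    have hj := hclass j (g j) (hlt j).le (hgn j).le (hg j)
    have h1 := hCmono hij.le
    have h2 := hCmono (hlt j).le
    have h3 := hCmono hlt'.le
    have hik : ¬ H.Adj (e i) (e (g j)) := fun h =>
      absurd (hmin i (g j) (hij.le.trans (hlt j).le) h) (not_le.mpr hlt')
    -- Either `g j` is one class after `i`, and then `j` shares the class of `i`; or `g j` and `g i`
    -- are both two classes after `i`. Nestedness makes `g j` a neighbour of `i` before its first
    -- one.
    by_cases hCk : C (g j) = C i + 1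
    · exact hik (hnext hij.le (by omega) hCk (hg j))
    · exact hik (hbwd hlt'.le (by omega) (by omega) (hg i))
  · intro i j hij hjn
    constructor
    · intro h
      exact ⟨hmin i j hij.le h, hmin j (i + n) hjn.le (by rw [hper]; exact h.symm)⟩
    · rintro ⟨h1, h2⟩
      have hi := hclass i (g i) (hlt i).le (hgn i).le (hg i)
      have hj := hclass j (g j) (hlt j).le (hgn j).le (hg j)
      have h3 := hCmono h1
      have h4 := hCmono h2
      have h5 := hCper i
      -- If `j` is two classes after `i`, adjacency is read from `j` to `i + n`, which is one class
      -- after `j`.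
      by_cases hCj : C j = C i + 1
      · exact hfwd h1 (by omega) (by omega) (hg i)
      · rw [← hper i]
        exact (hfwd h2 (by omega) (by omega) (hg j)).symm

/-- Residues modulo `n` and rounds, for a walk through `Fin n` in increasing order. -/
theorem exists_periodic_enumeration {n : ℕ} (hn : 0 < n) :
    ∃ (r : ℤ → Fin n) (q : ℤ → ℤ), (∀ i : ℤ, r (i + n) = r i) ∧
      (∀ i : ℤ, q (i + n) = q i + 1) ∧ (∀ i j : ℤ, i < j → j < i + n → r i ≠ r j) ∧
      (∀ a (i : ℤ), ∃ j, i ≤ j ∧ j < i + n ∧ r j = a) ∧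
      Monotone q ∧ ∀ i j : ℤ, i ≤ j → q i = q j → r i ≤ r j := by
  have hnZ : (0 : ℤ) < n := by exact_mod_cast hn
  have h₀ : ∀ i : ℤ, 0 ≤ i % n := fun i => Int.emod_nonneg i hnZ.ne'
  have h₁ : ∀ i : ℤ, i % n < n := fun i => Int.emod_lt_of_pos i hnZ
  refine ⟨fun i => ⟨(i % n).toNat, by have := h₀ i; have := h₁ i; omega⟩, fun i => i / n,
    ?_, ?_, ?_, ?_, ?_, ?_⟩
  · intro i
    simp
  · intro i
    simp only
    rw [Int.add_ediv_of_dvd_right (dvd_refl _), Int.ediv_self hnZ.ne']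
  · intro i j hij hjn h
    have h1 := h₀ i
    have h2 := h₀ j
    simp only [Fin.mk.injEq] at h
    have h3 : (j - i) % n = 0 := Int.emod_eq_emod_iff_emod_sub_eq_zero.mp (show j % n = i % n by omega)
    rw [Int.emod_eq_of_lt (by omega) (by omega)] at h3
    omega
  · intro a i
    have h1 := h₀ (a.val - i)
    have h2 := h₁ (a.val - i)
    refine ⟨i + (a.val - i) % n, by omega, by omega, Fin.ext ?_⟩
    have : (i + (a.val - i) % n) % n = (a.val : ℤ) := by
      rw [Int.add_emod_emod, add_sub_cancel]
      exact Int.emod_eq_of_lt (by omega) (by have := a.isLt; omega)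
    simp only [this, Int.toNat_natCast]
  · intro i j hij
    exact Int.ediv_le_ediv hnZ hij
  · intro i j hij h
    have h1 := Int.mul_ediv_add_emod i n
    have h2 := Int.mul_ediv_add_emod j n
    simp only at h
    rw [h] at h1
    simp only [Fin.mk_le_mk]
    omega

/-- The vertices can be listed by colour, and within a colour by decreasing `nextDegree`. -/
theorem exists_sorted_enumeration [Fintype V] (H : SimpleGraph V) [DecidableRel H.Adj]
    (c : V → Fin 3) :
    ∃ e : Fin (Fintype.card V) → V, Function.Bijective e ∧ ∀ a b, a ≤ b →
      (c (e a)).val ≤ (c (e b)).val ∧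
        (c (e a) = c (e b) → H.nextDegree c (e b) ≤ H.nextDegree c (e a)) := by
  let n := Fintype.card V
  -- A lexicographic key: the second summand is below `n + 1`, and by `hnd` its subtraction does not
  -- truncate, so it reverses the order of `nextDegree`.
  let key : V → ℕ := fun v => (c v).val * (n + 1) + (n - H.nextDegree c v)
  have hnd : ∀ v, H.nextDegree c v ≤ n := fun v => Finset.card_le_univ _
  let f : Fin n → V := (Fintype.equivFin V).symm
  refine ⟨f ∘ Tuple.sort (key ∘ f),
    (Fintype.equivFin V).symm.bijective.comp (Tuple.sort (key ∘ f)).bijective, ?_⟩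
  intro a b hab
  have h : key (f (Tuple.sort (key ∘ f) a)) ≤ key (f (Tuple.sort (key ∘ f) b)) :=
    Tuple.monotone_sort (key ∘ f) hab
  simp only [Function.comp_apply]
  generalize f (Tuple.sort (key ∘ f) a) = u at *
  generalize f (Tuple.sort (key ∘ f) b) = v at *
  have h1 := hnd u
  have h2 := hnd v
  simp only [key] at h
  constructor
  · by_contra! hlt
    have := Nat.mul_le_mul_right (n + 1) (Nat.succ_le_of_lt hlt)
    rw [Nat.succ_mul] at this
    omega
  · intro heq
    rw [heq] at h
    omega

theorem IsSaturatedColored.nonempty_circularOrdering [Fintype V] [Nonempty V] {H : SimpleGraph V}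
    [DecidableRel H.Adj] {c : V → Fin 3} (hH : H.IsSaturatedColored c)
    (hdeg : ∀ v, Fintype.card V < 3 * H.degree v) :
    Nonempty (H.CircularOrdering (Fintype.card V)) := by
  obtain ⟨e, hbij, he⟩ := exists_sorted_enumeration H c
  obtain ⟨r, q, hr, hq, hrne, hrsurj, hqmono, hrle⟩ :=
    exists_periodic_enumeration (n := Fintype.card V) Fintype.card_pos
  have hlt : ∀ v, ((c v).val : ℤ) < 3 := fun v => by
    have := (c v).isLt
    omega
  have heq : ∀ i j, ((c (e (r i))).val : ℤ) + 3 * q i = (c (e (r j))).val + 3 * q j →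
      q i = q j ∧ c (e (r i)) = c (e (r j)) := by
    intro i j h
    have := hlt (e (r i))
    have := hlt (e (r j))
    exact ⟨by omega, Fin.ext (by omega)⟩
  -- Colour plus three times the round lifts the cyclic order of the colours to ℤ.
  refine nonempty_circularOrdering_of_classes (fun i => e (r i))
    (fun i => (c (e (r i))).val + 3 * q i) ?_ ?_ ?_ ?_ ?_ ?_ ?_ ?_ ?_
  · intro i
    exact congrArg e (hr i)
  · intro i j hij hjn h
    exact hrne i j hij hjn (hbij.1 h)
  · intro v i
    obtain ⟨a, rfl⟩ := hbij.2 v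
    obtain ⟨j, h1, h2, h3⟩ := hrsurj a i
    exact ⟨j, h1, h2, congrArg e h3⟩
  · intro i j hij
    have := hlt (e (r i))
    have := hlt (e (r j))
    rcases (hqmono hij).lt_or_eq with h | h
    · simp only
      omega
    · have := (he _ _ (hrle i j hij h)).1
      simp only
      omega
  · intro i
    simp only [hr, hq]
    ring
  · intro i j h
    have := hlt (e (r i))
    have := hlt (e (r j))
    have h2 : (c (e (r i))).val ≠ (c (e (r j))).val := fun h' => hH.color_ne h (Fin.ext h')
    omega
  · intro i i' j hi hC hj h
    obtain ⟨h1, h2⟩ := heq _ _ hC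
    refine hH.adj_next_of_nextDegree_le hdeg h2 ((he _ _ (hrle _ _ hi h1)).2 h2) ?_ h
    omega
  · intro i i' j hi hC hj h
    obtain ⟨h1, h2⟩ := heq _ _ hC
    refine hH.adj_prev_of_nextDegree_le hdeg h2 ((he _ _ (hrle _ _ hi h1)).2 h2) ?_ h
    omega
  · intro v
    have := hdeg v
    obtain ⟨w, hw⟩ := (H.degree_pos_iff_exists_adj v).mp (by omega)
    exact ⟨w, hw⟩

/-! ### Immersions from a circular ordering -/

namespace CircularOrdering

variable {H : SimpleGraph V} {n : ℤ}

/-- If three jumps stayed within one period, `i` and its first two jumps would form a triangle. -/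
theorem lt_reach_reach_reach (O : H.CircularOrdering n)
    (ht : ∀ {u v w}, H.Adj u v → H.Adj v w → ¬ H.Adj u w) (i : ℤ) :
    i + n < O.reach (O.reach (O.reach i)) := by
  by_contra! h
  have h1 := O.lt_reach i
  have h2 := O.lt_reach (O.reach i)
  have h3 := O.lt_reach (O.reach (O.reach i))
  refine ht (u := O.vertex i) (v := O.vertex (O.reach i)) (w := O.vertex (O.reach (O.reach i)))
    ?_ ?_ ?_
  · rw [O.adj_iff] <;> omega
  · rw [O.adj_iff] <;> omega
  · rw [O.adj_iff] <;> omega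

/-- If the complement of a circularly ordered triangle-free graph has no clique on more than `h`
consecutive vertices, it strongly immerses a complete graph on the other `n - h` vertices. -/
theorem containsStrongImmersion [Finite V] (O : H.CircularOrdering n)
    (ht : ∀ {u v w}, H.Adj u v → H.Adj v w → ¬ H.Adj u w) {G : SimpleGraph V}
    (hG : ∀ {u v}, u ≠ v → ¬ H.Adj u v → G.Adj u v) {h m : ℕ} (hn : (m : ℤ) + h = n)
    (hhm : h ≤ m) (hmh : m ≤ h + 1) (hm : (m : ℤ) < n) (hreach : ∀ i, O.reach i ≤ i + h) :
    G.ContainsStrongImmersion (completeGraph (Fin m)) := by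
  have hT := O.lt_reach_reach_reach ht
  have hmono := O.reach_mono
  have hadj : ∀ i j, i < j → j < i + n → (j < O.reach i ∨ i + n < O.reach j) →
      G.Adj (O.vertex i) (O.vertex j) := by
    intro i j h1 h2 h3
    refine hG (O.vertex_ne h1 h2) ?_
    rw [O.adj_iff h1 h2]
    omega
  have hinj : ∀ a i j : ℤ, a ≤ i → a ≤ j → i < a + n → j < a + n → O.vertex i = O.vertex j →
      i = j := by
    intro a i j h1 h2 h3 h4 h
    rcases lt_trichotomy i j with hlt | heq | hlt
    · exact absurd h (O.vertex_ne hlt (by omega))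
    · exact heq
    · exact absurd h.symm (O.vertex_ne hlt (by omega))
  -- `t x` is the backward counterpart of `reach`: the last position whose first neighbour comes no
  -- later than `x + n`.
  have hlast : ∀ x, ∃ t, O.reach t ≤ x + n ∧ ∀ j, O.reach j ≤ x + n → j ≤ t := by
    intro x
    exact Int.exists_greatest_of_bdd ⟨x + n, fun z hz => ((O.lt_reach z).trans_le hz).le⟩
      ⟨x, (hreach x).trans (by omega)⟩
  choose t ht₁ ht₂ using hlast
  have ht₀ : ∀ x, x ≤ t x := fun x => ht₂ x x ((hreach x).trans (by omega))
  -- The branch vertices will start just after a `p` minimising `t p - p`; the minimum over ℤ exists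
  -- because these differences are nonnegative.
  obtain ⟨p, hp⟩ : ∃ p, ∀ x, t p - p ≤ t x - x := by
    refine ⟨Function.argmin (fun x => (t x - x).toNat), fun x => ?_⟩
    have := Function.argmin_le (fun x => (t x - x).toNat) x
    have := ht₀ x
    have := ht₀ (Function.argmin (fun x => (t x - x).toNat))
    omega
  set s : ℤ := p + 1 with hs
  have htp : s + m - 1 ≤ t p := ht₂ p (s + m - 1) ((hreach _).trans (by omega))
  have htr : ∀ x, t x < O.reach (O.reach x) := by
    intro x
    by_contra! hcon
    have := hmono hcon
    have := ht₁ x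
    have := hT x
    omega
  have hrt : ∀ z, t p < z → p + n < O.reach z := by
    intro z hz
    by_contra! hcon
    have := ht₂ p z hcon
    omega
  let b : Fin m ↪ V := ⟨fun x => O.vertex (s + x.val), fun x y hxy => by
    have := hinj s _ _ (by omega) (by omega) (by omega) (by omega) hxy
    exact Fin.ext (by omega)⟩
  -- With `x`, `y` as positions, minimality of `p` gives `t p + (x - p) ≤ t x < reach (reach x) ≤
  -- reach y`. So the position of τ precedes that of σ, and both lie between `s + m` and `s + n -
  -- 1`, off the branch vertices.
  have hbad : ∀ x y : ℤ, s ≤ x → x < y → y < s + m → O.reach x ≤ y →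
      s + m ≤ t p + 1 + (x - s) ∧ t p + 1 + (x - s) < O.reach y ∧ O.reach y ≤ y + h := by
    intro x y h1 h2 h3 h4
    have := hp x
    have := htr x
    have := hmono h4
    exact ⟨by omega, by omega, hreach y⟩
  -- On a detour, `b x` and `σ y` are adjacent because three jumps from `x` exceed a full turn, `σ
  -- y` and `τ x` because every position after `t p` reaches beyond `p + n`, and `τ x` and `b y`
  -- because `τ x` comes before the first neighbour of `b y`.
  refine containsStrongImmersion_completeGraph_of_detours b
    (fun y => O.vertex (s + y.val + h)) (fun x => O.vertex (t p + 1 + x.val))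
    (fun x y => x < y ∧ O.reach (s + x.val) ≤ s + y.val) ?_ ?_ ?_ ?_ ?_ ?_ ?_ ?_ ?_ ?_
  · intro x y hxy hB
    have hxy' : x.val < y.val := hxy
    exact hadj _ _ (by omega) (by omega) (Or.inl (by simpa [hxy] using hB))
  · rintro x y ⟨hxy, hB⟩ w heq
    have hxy' : x.val < y.val := hxy
    obtain ⟨h1, h2, h3⟩ := hbad (s + x.val) (s + y.val) (by omega) (by omega) (by omega) hB
    have := hinj s _ _ (by omega) (by omega) (by omega) (by omega) heq
    omega
  · rintro x y ⟨hxy, hB⟩ w heq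
    have hxy' : x.val < y.val := hxy
    obtain ⟨h1, h2, h3⟩ := hbad (s + x.val) (s + y.val) (by omega) (by omega) (by omega) hB
    have := hinj s _ _ (by omega) (by omega) (by omega) (by omega) heq
    omega
  · rintro x y ⟨hxy, hB⟩
    have hxy' : x.val < y.val := hxy
    obtain ⟨h1, h2, h3⟩ := hbad (s + x.val) (s + y.val) (by omega) (by omega) (by omega) hB
    have h4 := hmono (hmono hB)
    have h5 := hmono h3
    have h6 := hT (s + x.val)
    exact hadj _ _ (by omega) (by omega) (Or.inr (by omega))
  · rintro x y ⟨hxy, hB⟩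
    have hxy' : x.val < y.val := hxy
    obtain ⟨h1, h2, h3⟩ := hbad (s + x.val) (s + y.val) (by omega) (by omega) (by omega) hB
    have h4 := hrt (t p + 1 + x.val) (by omega)
    exact (hadj _ _ (by omega) (by omega) (Or.inl (by omega))).symm
  · rintro x y ⟨hxy, hB⟩
    have hxy' : x.val < y.val := hxy
    obtain ⟨h1, h2, h3⟩ := hbad (s + x.val) (s + y.val) (by omega) (by omega) (by omega) hB
    exact (hadj _ _ (by omega) (by omega) (Or.inl (by omega))).symm
  · intro x y hxy
    have := hinj (s + h) _ _ (by omega) (by omega) (by omega) (by omega) hxy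
    exact Fin.ext (by omega)
  · intro x y hxy
    have := hinj (t p + 1) _ _ (by omega) (by omega) (by omega) (by omega) hxy
    exact Fin.ext (by omega)
  · rintro x y z ⟨hxy, hB⟩ ⟨hyz, hB'⟩
    have h1 := hmono (hmono hB)
    have h2 := hmono hB'
    have h3 := hT (s + x.val)
    have h4 := hreach (s + z.val)
    omega
  -- For each bad pair τ strictly precedes σ, so the two equalities would give a cyclic chain of
  -- strict inequalities.
  · rintro x y x' y' ⟨hxy, hB⟩ ⟨hxy', hB'⟩ heq heq'
    have hlt : x.val < y.val := hxy
    have hlt' : x'.val < y'.val := hxy'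
    obtain ⟨h1, h2, h3⟩ := hbad (s + x.val) (s + y.val) (by omega) (by omega) (by omega) hB
    obtain ⟨h1', h2', h3'⟩ := hbad (s + x'.val) (s + y'.val) (by omega) (by omega) (by omega) hB'
    have := hinj s _ _ (by omega) (by omega) (by omega) (by omega) heq
    have := hinj s _ _ (by omega) (by omega) (by omega) (by omega) heq'
    omega

/-- Consecutive vertices before the first neighbour form a clique in the complement. -/
theorem reach_le_of_cliqueNum_le [Finite V] (O : H.CircularOrdering n) {G : SimpleGraph V}
    (hG : ∀ {u v}, u ≠ v → ¬ H.Adj u v → G.Adj u v) {h : ℕ} (hh : (h : ℤ) < n)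
    (hω : G.cliqueNum ≤ h) (i : ℤ) : O.reach i ≤ i + h := by
  classical
  by_contra! hcon
  have hne : ∀ a b : ℕ, a < b → b < h + 1 → O.vertex (i + a) ≠ O.vertex (i + b) :=
    fun a b hab hb => O.vertex_ne (by omega) (by omega)
  have hadj : ∀ a b : ℕ, a < b → b < h + 1 → G.Adj (O.vertex (i + a)) (O.vertex (i + b)) := by
    intro a b hab hb
    refine hG (hne a b hab hb) ?_
    rw [O.adj_iff (by omega) (by omega)]
    have := O.reach_mono (show i ≤ i + a by omega)
    omega
  have hcl : G.IsClique ((Finset.range (h + 1)).image fun a : ℕ => O.vertex (i + a)) := by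
    intro u hu v hv huv
    simp only [Finset.coe_image, Finset.coe_range, Set.mem_image, Set.mem_Iio] at hu hv
    obtain ⟨a, ha, rfl⟩ := hu
    obtain ⟨b, hb, rfl⟩ := hv
    rcases lt_trichotomy a b with hab | rfl | hab
    · exact hadj a b hab hb
    · exact absurd rfl huv
    · exact (hadj b a hab ha).symm
  have hcard := hcl.card_le_cliqueNum
  rw [Finset.card_image_of_injOn, Finset.card_range] at hcard
  · omega
  · intro a ha b hb hab
    simp only [Finset.coe_range, Set.mem_Iio] at ha hb
    rcases lt_trichotomy a b with hlt | heq | hlt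
    · exact absurd hab (hne a b hlt hb)
    · exact heq
    · exact absurd hab.symm (hne b a hlt ha)

end CircularOrdering

/-! ### Matchings in the complement and the chromatic number -/

/-- If deleting `S` from a triangle-free graph of large minimum degree leaves more than `|S|`
pieces, then the remaining vertices are independent. -/
theorem not_adj_of_card_lt_card_pieces [Fintype V] {H : SimpleGraph V} [DecidableRel H.Adj]
    (ht : ∀ {u v w}, H.Adj u v → H.Adj v w → ¬ H.Adj u w)
    (hdeg : ∀ v, Fintype.card V < 3 * H.degree v) {ι : Type*} [Fintype ι] (S : Finset V)
    (P : V → ι) (hP : ∀ a, ∃ v, v ∉ S ∧ P v = a)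
    (hadj : ∀ u v, u ∉ S → v ∉ S → H.Adj u v → P u = P v)
    (hcard : S.card < Fintype.card ι) (htwo : 2 ≤ Fintype.card ι) {u v : V} (hu : u ∉ S)
    (hv : v ∉ S) : ¬ H.Adj u v := by
  classical
  intro huv
  let C : ι → Finset V := fun a => Finset.univ.filter fun x => x ∉ S ∧ P x = a
  have hSC : ∀ a, Disjoint S (C a) := fun a => by
    rw [Finset.disjoint_right]
    intro x hx
    exact (Finset.mem_filter.mp hx).2.1
  -- The ends of an edge have disjoint neighbourhoods inside `S` and their piece, which together
  -- therefore have more than 2n/3 vertices.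
  have hpiece : ∀ u v, u ∉ S → v ∉ S → H.Adj u v →
      2 * Fintype.card V + 2 ≤ 3 * (S.card + (C (P u)).card) := by
    intro u v hu hv huv
    have hdisj : Disjoint (H.neighborFinset u) (H.neighborFinset v) := by
      rw [Finset.disjoint_left]
      intro x hx hx'
      rw [mem_neighborFinset] at hx hx'
      exact ht huv hx' hx
    have hsub : H.neighborFinset u ∪ H.neighborFinset v ⊆ S ∪ C (P u) := by
      intro x hx
      rw [Finset.mem_union, mem_neighborFinset, mem_neighborFinset] at hx
      rw [Finset.mem_union]
      by_cases hxS : x ∈ S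
      · exact Or.inl hxS
      · refine Or.inr (Finset.mem_filter.mpr ⟨Finset.mem_univ _, hxS, ?_⟩)
        rcases hx with hx | hx
        · exact (hadj u x hu hxS hx).symm
        · exact (hadj v x hv hxS hx).symm.trans (hadj u v hu hv huv).symm
    have h := Finset.card_le_card hsub
    rw [Finset.card_union_of_disjoint hdisj, Finset.card_union_of_disjoint (hSC _),
      card_neighborFinset_eq_degree, card_neighborFinset_eq_degree] at h
    have := hdeg u
    have := hdeg v
    omega
  have hC := hpiece u v hu hv huv
  -- Every other piece has a vertex, and there are at least |S| of them; with `hC` this forces |S| <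
  -- n/3.
  have hrest : S.card + (C (P u)).card + (Fintype.card ι - 1) ≤ Fintype.card V := by
    choose f hfS hfP using hP
    have hdisj : Disjoint (S ∪ C (P u)) ((Finset.univ.erase (P u)).image f) := by
      rw [Finset.disjoint_right]
      intro x hx hx'
      obtain ⟨a, ha, rfl⟩ := Finset.mem_image.mp hx
      rw [Finset.mem_union, Finset.mem_filter] at hx'
      rcases hx' with hx' | hx'
      · exact hfS a hx'
      · exact (Finset.mem_erase.mp ha).1 ((hfP a).symm.trans hx'.2.2)
    have h := Finset.card_le_univ ((S ∪ C (P u)) ∪ (Finset.univ.erase (P u)).image f)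
    rw [Finset.card_union_of_disjoint hdisj, Finset.card_union_of_disjoint (hSC _),
      Finset.card_image_of_injective _ (fun a b hab => by rw [← hfP a, ← hfP b, hab]),
      Finset.card_erase_of_mem (Finset.mem_univ _), Finset.card_univ] at h
    exact h
  obtain ⟨a, ha⟩ : ∃ a, a ≠ P u := by
    have : Nontrivial ι := Fintype.one_lt_card_iff_nontrivial.mp htwo
    exact exists_ne _
  obtain ⟨w, hwS, rfl⟩ := hP a
  -- The degree of `w` exceeds |S|, so a second piece carries an edge and also fills more than 2n/3
  -- together with `S`. As the two pieces and `S` are disjoint, |S| > n/3, a contradiction.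
  obtain ⟨w', hww', hw'S⟩ : ∃ w', H.Adj w w' ∧ w' ∉ S := by
    by_contra! hcon
    have h := Finset.card_le_card (show H.neighborFinset w ⊆ S from fun x hx =>
      hcon x ((H.mem_neighborFinset w x).mp hx))
    rw [card_neighborFinset_eq_degree] at h
    have := hdeg w
    omega
  have hC' := hpiece w w' hwS hw'S hww'
  have hdisj : Disjoint (S ∪ C (P u)) (C (P w)) := by
    rw [Finset.disjoint_right]
    intro x hx hx'
    rw [Finset.mem_filter] at hx
    rw [Finset.mem_union, Finset.mem_filter] at hx'
    rcases hx' with hx' | hx'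
    · exact hx.2.1 hx'
    · exact ha (hx.2.2.symm.trans hx'.2.2)
  have h := Finset.card_le_univ ((S ∪ C (P u)) ∪ C (P w))
  rw [Finset.card_union_of_disjoint hdisj, Finset.card_union_of_disjoint (hSC _)] at h
  omega

/-- The join of `H` with a complete graph on `D`. -/
def joinComplete (H : SimpleGraph V) (D : Type*) : SimpleGraph (V ⊕ D) where
  Adj a b := a ≠ b ∧ ∀ x y, a = .inl x → b = .inl y → H.Adj x y
  symm := ⟨fun _ _ h => ⟨h.1.symm, fun x y hx hy => (h.2 y x hy hx).symm⟩⟩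
  loopless := ⟨fun _ h => h.1 rfl⟩

theorem joinComplete_adj_inl {H : SimpleGraph V} {D : Type*} {x y : V} :
    (H.joinComplete D).Adj (.inl x) (.inl y) ↔ H.Adj x y :=
  ⟨fun h => h.2 x y rfl rfl, fun h => ⟨fun h' => h.ne (Sum.inl.inj h'), fun _ _ hx hy =>
    Sum.inl.inj hx ▸ Sum.inl.inj hy ▸ h⟩⟩

theorem joinComplete_adj_inr {H : SimpleGraph V} {D : Type*} {a : V ⊕ D} {d : D}
    (h : a ≠ .inr d) : (H.joinComplete D).Adj a (.inr d) :=
  ⟨h, fun _ _ _ hy => absurd hy Sum.inr_ne_inl⟩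

/-- The `d` added vertices absorb those left unmatched in `H`. If a Tutte violator leaves at least
two components, it contains all added vertices, and its trace `S` on `V` leaves more than |S| + d
pieces. The vertices outside `S` are then independent, so n - |S| ≤ k and |S| + d ≥ k; but they
number at least as many as the pieces, hence more than k. -/
theorem exists_isPerfectMatching_joinComplete [Fintype V] {H : SimpleGraph V}
    [DecidableRel H.Adj] (ht : ∀ {u v w}, H.Adj u v → H.Adj v w → ¬ H.Adj u w)
    (hdeg : ∀ v, Fintype.card V < 3 * H.degree v) {k d : ℕ} (hd : Fintype.card V + d = 2 * k)
    (hindep : H.indepNum ≤ k) :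
    ∃ M : (H.joinComplete (Fin d)).Subgraph, M.IsPerfectMatching := by
  classical
  rw [tutte]
  intro u hu
  rw [IsTutteViolator] at hu
  set Q := ((⊤ : (H.joinComplete (Fin d)).Subgraph).deleteVerts u).coe with hQ
  have hodd : Q.oddComponents.ncard ≤ Nat.card Q.ConnectedComponent := Set.ncard_le_card _
  have hmem : ∀ a, a ∉ u →
      a ∈ ((⊤ : (H.joinComplete (Fin d)).Subgraph).deleteVerts u).verts := fun a ha => by
    simpa using ha
  have hQadj : ∀ a b (ha : a ∉ u) (hb : b ∉ u), (H.joinComplete (Fin d)).Adj a b →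
      Q.connectedComponentMk ⟨a, hmem a ha⟩ = Q.connectedComponentMk ⟨b, hmem b hb⟩ := by
    intro a b ha hb hab
    apply ConnectedComponent.sound
    apply Adj.reachable
    simp [hQ, ha, hb, hab]
  rcases lt_or_ge (Nat.card Q.ConnectedComponent) 2 with hlt | htwo
  -- With at most one component the violator is empty and the whole join is odd, although it has 2k
  -- vertices.
  · have hu0 : u.ncard = 0 := by omega
    have h1 : Q.oddComponents.ncard = 1 := by omega
    have h2 : Odd Q.oddComponents.ncard := by rw [h1]; exact odd_one
    rw [odd_ncard_oddComponents] at h2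
    rw [Set.ncard_eq_zero] at hu0
    subst hu0
    rw [Nat.card_coe_set_eq] at h2
    simp only [Subgraph.deleteVerts_empty, Subgraph.verts_top, Set.ncard_univ,
      Nat.card_eq_fintype_card, Fintype.card_sum, Fintype.card_fin, hd] at h2
    exact absurd h2 (by simp)
  · have hinr : ∀ x, Sum.inr x ∈ u := by
      intro x
      by_contra hx
      have hall : ∀ c : Q.ConnectedComponent, c = Q.connectedComponentMk ⟨.inr x, hmem _ hx⟩ := by
        intro c
        induction c using ConnectedComponent.ind with
        | _ a =>
          obtain ⟨a, ha⟩ := a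
          by_cases hax : a = .inr x
          · subst hax; rfl
          · exact hQadj a _ (by simpa using ha) hx (joinComplete_adj_inr hax)
      have : Subsingleton Q.ConnectedComponent := ⟨fun a b => (hall a).trans (hall b).symm⟩
      have := Finite.card_le_one_iff_subsingleton.mpr this
      omega
    let S : Finset V := Finset.univ.filter fun x => Sum.inl x ∈ u
    have hS : ∀ x, x ∉ S ↔ Sum.inl x ∉ u := fun x => by simp [S]
    have hucard : u.ncard = S.card + d := by
      have : u = ((S.disjSum Finset.univ : Finset (V ⊕ Fin d)) : Set (V ⊕ Fin d)) := by
        ext a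
        rcases a with a | a
        · simp [S]
        · simpa using hinr a
      rw [this, Set.ncard_coe_finset, Finset.card_disjSum, Finset.card_univ, Fintype.card_fin]
    have hne : Nonempty Q.ConnectedComponent := Finite.card_pos_iff.mp (by omega)
    let P : V → Q.ConnectedComponent := fun x =>
      if h : Sum.inl x ∉ u then Q.connectedComponentMk ⟨.inl x, hmem _ h⟩ else hne.some
    have hP : ∀ a, ∃ v, v ∉ S ∧ P v = a := by
      intro c
      induction c using ConnectedComponent.ind with
      | _ a =>
        obtain ⟨a, ha⟩ := a
        have hau : a ∉ u := by simpa using ha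
        rcases a with a | a
        · exact ⟨a, (hS a).mpr hau, by simp only [P, dif_pos hau]⟩
        · exact absurd (hinr a) hau
    have hPadj : ∀ u v, u ∉ S → v ∉ S → H.Adj u v → P u = P v := by
      intro x y hx hy hxy
      rw [hS] at hx hy
      simp only [P, dif_pos hx, dif_pos hy]
      exact hQadj _ _ hx hy (joinComplete_adj_inl.mpr hxy)
    have : Fintype Q.ConnectedComponent := Fintype.ofFinite _
    rw [Nat.card_eq_fintype_card] at hodd htwo
    have hind : H.IsIndepSet (Sᶜ : Finset V) := by
      intro x hx y hy _
      exact not_adj_of_card_lt_card_pieces ht hdeg S P hP hPadj (by omega) htwo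
        (by simpa using hx) (by simpa using hy)
    have h1 := hind.card_le_indepNum
    have h2 : Fintype.card Q.ConnectedComponent ≤ (Sᶜ).card := by
      choose f hfS hfP using hP
      rw [← Finset.card_univ]
      exact Finset.card_le_card_of_injOn f (fun a _ => by simpa using hfS a)
        (fun a _ b _ hab => by rw [← hfP a, ← hfP b, hab])
    rw [Finset.card_compl] at h1 h2
    omega

/-- A perfect matching of the complement joined with a complete graph colours the graph. -/
theorem colorable_of_isPerfectMatching [Fintype V] {G : SimpleGraph V} {k d : ℕ}
    (hd : Fintype.card V + d = 2 * k) {M : (Gᶜ.joinComplete (Fin d)).Subgraph}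
    (hM : M.IsPerfectMatching) : G.Colorable k := by
  classical
  have hdeg : ∀ v, M.spanningCoe.degree v = 1 := by
    intro v
    rw [Subgraph.degree_spanningCoe]
    exact Subgraph.isPerfectMatching_iff_forall_degree.mp hM v
  have hcard : Fintype.card M.spanningCoe.edgeSet = k := by
    have h := M.spanningCoe.sum_degrees_eq_twice_card_edges
    simp only [hdeg, Finset.sum_const, Finset.card_univ, smul_eq_mul, mul_one,
      Fintype.card_sum, Fintype.card_fin, hd] at h
    rw [← edgeFinset_card]
    omega
  choose f hf using fun v => (Subgraph.isPerfectMatching_iff.mp hM v).exists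
  -- The colours are the k matching edges; two vertices of `V` on the same one are adjacent in the
  -- complement.
  let col : G.Coloring M.spanningCoe.edgeSet := Coloring.mk
    (fun v => ⟨s(.inl v, f (.inl v)), hf (.inl v)⟩) (by
      intro v w hvw heq
      have h := congrArg Subtype.val heq
      rcases Sym2.eq_iff.mp h with ⟨h1, -⟩ | ⟨-, h2⟩
      · exact hvw.ne (Sum.inl.inj h1)
      · have h3 := (hf (.inl v)).adj_sub
        rw [h2, joinComplete_adj_inl, compl_adj] at h3
        exact h3.2 hvw)
  rw [← hcard]
  exact col.colorable

/-! ### From clique covers and cliques to the theorem -/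

theorem exists_coloring_compl_of_cliqueCoveringNumber_le {G : SimpleGraph V} {k : ℕ}
    (h : G.cliqueCoveringNumber ≤ k) :
    ∃ c : V → Fin k, ∀ u v, Gᶜ.Adj u v → c u ≠ c v := by
  obtain ⟨l, hl, C, hC, hU⟩ : ∃ l ≤ k, ∃ C : Fin l → Set V,
      (∀ i, G.IsClique (C i)) ∧ ⋃ i, C i = Set.univ := by
    by_contra! hcon
    have : ((k + 1 : ℕ) : ℕ∞) ≤ G.cliqueCoveringNumber := by
      refine le_iInf₂ fun l hl => ?_
      obtain ⟨C, hC, hU⟩ := hl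
      by_contra! hlt
      exact hcon l (Nat.lt_succ_iff.mp (by exact_mod_cast hlt)) C hC hU
    have h' := this.trans h
    have : k + 1 ≤ k := by exact_mod_cast h'
    omega
  have hmem : ∀ v, ∃ i, v ∈ C i := fun v => by
    simpa using (hU ▸ Set.mem_univ v : v ∈ ⋃ i, C i)
  choose f hf using hmem
  refine ⟨fun v => Fin.castLE hl (f v), fun u v huv heq => ?_⟩
  have heq' : f u = f v := Fin.castLE_injective hl heq
  rw [compl_adj] at huv
  exact huv.2 (hC (f u) (hf u) (by rw [heq']; exact hf v) huv.1)

theorem ContainsStrongImmersion.mono_completeGraph [Finite V] {G : SimpleGraph V} {k l : ℕ}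
    (h : G.ContainsStrongImmersion (completeGraph (Fin l))) (hkl : k ≤ l) :
    G.ContainsStrongImmersion (completeGraph (Fin k)) := by
  obtain ⟨I, ⟨M, hM⟩, -⟩ := h
  let ι : Fin k ↪ Fin l := Fin.castLEEmb hkl
  have hadj : ∀ u v, (completeGraph (Fin k)).Adj u v → (completeGraph (Fin l)).Adj (ι u) (ι v) :=
    fun u v huv h => huv (ι.injective h)
  have hedge : ∀ e ∈ (completeGraph (Fin k)).edgeSet,
      Sym2.map ι e ∈ (completeGraph (Fin l)).edgeSet := by
    intro e he
    induction e with
    | _ u v => exact hadj u v he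
  let M' : ImmersionModel (completeGraph (Fin k)) I :=
    { branch := ι.trans M.branch
      branch_mem := fun w => M.branch_mem _
      path := fun e => M.path (Sym2.map ι e)
      path_le := fun e he => M.path_le _ (hedge e he)
      isPath := fun u v huv => M.isPath _ _ (hadj u v huv)
      edge_disjoint := fun e he f hf hef => M.edge_disjoint (hedge e he) (hedge f hf)
        fun h => hef (Sym2.map.injective ι.injective h) }
  have hM' : M'.IsStrong := fun u v huv w hw => by
    rcases hM _ _ (hadj u v huv) (ι w) hw with h | h
    · exact Or.inl (ι.injective h)
    · exact Or.inr (ι.injective h)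
  obtain ⟨J, -, hJ⟩ := (Set.toFinite {J : G.Subgraph |
    ∃ M : ImmersionModel (completeGraph (Fin k)) J, M.IsStrong}).exists_le_minimal
      (show I ∈ _ from ⟨M', hM'⟩)
  exact ⟨J, hJ⟩

theorem containsStrongImmersion_completeGraph_cliqueNum [Finite V] (G : SimpleGraph V) :
    G.ContainsStrongImmersion (completeGraph (Fin G.cliqueNum)) := by
  obtain ⟨s, hs⟩ := G.exists_isNClique_cliqueNum
  let b := (s.equivFinOfCardEq hs.card_eq).symm
  refine containsStrongImmersion_completeGraph_of_isClique
    (b.toEmbedding.trans (Function.Embedding.subtype _)) fun x y hxy => ?_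
  exact hs.isClique (b x).2 (b y).2 fun h => hxy (b.injective (Subtype.ext h))

/-- A graph with triangle-free three-colourable complement of large minimum degree, in which the
largest clique has at most half of the vertices, strongly immerses a complete graph on half of its
vertices. -/
theorem containsStrongImmersion_completeGraph_half [Fintype V] [Nonempty V] {G : SimpleGraph V}
    [DecidableRel Gᶜ.Adj] (ht : ∀ {u v w}, Gᶜ.Adj u v → Gᶜ.Adj v w → ¬ Gᶜ.Adj u w)
    (hdeg : ∀ v, Fintype.card V < 3 * Gᶜ.degree v) (c : V → Fin 3)
    (hc : ∀ u v, Gᶜ.Adj u v → c u ≠ c v) {h m : ℕ} (hn : m + h = Fintype.card V) (hhm : h ≤ m)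
    (hmh : m ≤ h + 1) (hω : G.cliqueNum ≤ h) :
    G.ContainsStrongImmersion (completeGraph (Fin m)) := by
  classical
  -- Saturating adds edges only to the complement side, so nonadjacent vertices of `H` are still
  -- adjacent in `G` and the degree bound survives.
  obtain ⟨H, hle, hH⟩ := exists_isSaturatedColored_le Gᶜ c (hc _ _) ht
  have hdegH : ∀ v, Fintype.card V < 3 * H.degree v := fun v =>
    (hdeg v).trans_le (Nat.mul_le_mul_left 3 (degree_le_of_le hle))
  obtain ⟨O⟩ := hH.nonempty_circularOrdering hdegH
  have hG : ∀ {u v}, u ≠ v → ¬ H.Adj u v → G.Adj u v := fun {u v} huv hnot => by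
    by_contra hG
    exact hnot (hle ((compl_adj G u v).mpr ⟨huv, hG⟩))
  obtain ⟨v⟩ := ‹Nonempty V›
  have hpos : 0 < G.cliqueNum := by
    have : G.IsClique (({v} : Finset V) : Set V) := by simp
    exact Finset.card_pos.mpr (Finset.singleton_nonempty v) |>.trans_le this.card_le_cliqueNum
  exact O.containsStrongImmersion hH.no_triangle hG (by exact_mod_cast hn) hhm hmh (by omega)
    (O.reach_le_of_cliqueNum_le hG (by omega) hω)

end SimpleGraph

theorem theorem1p4 {V : Type*} [Fintype V] (G : SimpleGraph V) [DecidableRel G.Adj]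
    (hα : G.indepNum = 2)
    (hcover : G.cliqueCoveringNumber ≤ 3)
    (hΔ : (G.maxDegree : ℝ) < 2 * (Fintype.card V : ℝ) / 3 - 1) :
    G.ContainsStrongImmersion
      (SimpleGraph.completeGraph (Fin G.chromaticNumber.toNat)) := by
  classical
  have hne : Nonempty V := by
    by_contra hempty
    rw [not_nonempty_iff] at hempty
    rw [Fintype.card_eq_zero] at hΔ
    norm_num at hΔ
  have ht : ∀ {u v w}, Gᶜ.Adj u v → Gᶜ.Adj v w → ¬ Gᶜ.Adj u w := by
    intro u v w huv hvw huw
    have hcl : Gᶜ.IsClique (({u, v, w} : Finset V) : Set V) :=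
      (SimpleGraph.is3Clique_triple_iff.mpr ⟨huv, huw, hvw⟩).isClique
    have h := hcl.card_le_cliqueNum
    rw [SimpleGraph.cliqueNum_compl, hα,
      Finset.card_eq_three.mpr ⟨u, v, w, huv.ne, huw.ne, hvw.ne, rfl⟩] at h
    omega
  have hdeg : ∀ v, Fintype.card V < 3 * Gᶜ.degree v := by
    intro v
    have h1 : 3 * (G.maxDegree + 1) < 2 * Fintype.card V := by
      have : (3 * (G.maxDegree + 1) : ℝ) < 2 * Fintype.card V := by linarith
      exact_mod_cast this
    have h2 := G.degree_le_maxDegree v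
    have h3 := G.degree_compl (v := v)
    omega
  obtain ⟨c, hc⟩ := SimpleGraph.exists_coloring_compl_of_cliqueCoveringNumber_le hcover
  have hcolor : ∀ k, Fintype.card V ≤ 2 * k → G.cliqueNum ≤ k →
      G.chromaticNumber.toNat ≤ k := by
    intro k hk hω
    obtain ⟨M, hM⟩ := SimpleGraph.exists_isPerfectMatching_joinComplete ht hdeg
      (Nat.add_sub_cancel' hk) (by rwa [SimpleGraph.indepNum_compl])
    have hcol := SimpleGraph.colorable_of_isPerfectMatching (Nat.add_sub_cancel' hk) hM
    exact ENat.toNat_le_of_le_natCast hcol.chromaticNumber_le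
  by_cases hbig : Fintype.card V ≤ 2 * G.cliqueNum
  · exact G.containsStrongImmersion_completeGraph_cliqueNum.mono_completeGraph
      (hcolor _ hbig le_rfl)
  · exact (SimpleGraph.containsStrongImmersion_completeGraph_half ht hdeg c hc
      (h := Fintype.card V / 2) (m := (Fintype.card V + 1) / 2) (by omega) (by omega) (by omega)
      (by omega)).mono_completeGraph (hcolor _ (by omega) (by omega))
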